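/- Consider the four trace triples $(t_1,t_2,t_3)$: (I) $(\sqrt5,\,2\sqrt5,\,5)$; (II) $(\sqrt6,\,2\sqrt3,\,3\sqrt2)$; (III) $(2\sqrt2,\,2\sqrt2,\,4)$; (IV) $(3,3,3)$. In each case let $\alpha,\beta\in \mathrm{SL}_2(\mathbb R)$ satisfy $(\operatorname{Tr}\alpha,\operatorname{Tr}\beta,\operatorname{Tr}\alpha\beta)=(t_1,t_2,t_3)$. Let $Z$ be either $\{1\}$ or $\{\pm1\}$, and let $\Gamma=\langle \alpha,\beta, Z\rangle$; for $Z=\{\pm1\}$ this is the full inverse image in $\mathrm{SL}_2(\mathbb R)$ of the subgroup of $\mathrm{PSL}_2(\mathbb R)$ generated by the images of $\alpha$ and $\beta$. Let $\Gamma^{(2)}=\langle\gamma^2:\gamma\in\Gamma\rangle$, let $B\subset M_2(\mathbb R)$ be the $\mathbb Q$-vector space spanned by $1,\alpha^2,\beta^2,\alpha^2\beta^2$, and for a subgroup $H\subset\mathrm{SL}_2(\mathbb R)$ let $\mathbb Z[H]\subset M_2(\mathbb R)$ be the subring generated by $H$. Such a ring is called an order in $B$ if it is finitely generated as a $\mathbb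 Z$-module and its $\mathbb Q$-span is $B$. Let $$\Gamma'=\begin{cases}\langle\Gamma^{(2)},\alpha\beta,Z\rangle&\text{in cases I and III},\\ \langle\Gamma^{(2)},Z\rangle&\text{in case II},\\ \Gamma&\text{in case IV}.\end{cases}$$ Then: 1. $\Gamma'$ is the largest subgroup $H$ with $\Gamma^{(2)}\subset H\subset\Gamma$ such that $\mathbb Z[H]$ is an order in $B$. 2. There is a $g\in\mathrm{GL}_2(\mathbb R)$ such that $g\,\mathbb Z[\Gamma']\,g^{-1}\subset M_2(\mathbb Z)$. 3. For every such $g$, $$g\Gamma' g^{-1}=g\Gamma g^{-1}\cap \mathrm{SL}_2(\mathbb Z).$$ -/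

import Mathlib

open scoped MatrixGroups

noncomputable section

namespace OncePunctured

/-- The four trace triples of the arithmetic `(1; ∞)`-groups. -/
inductive TraceCase
  | I
  | II
  | III
  | IV

/-- The triple `(Tr α, Tr β, Tr αβ)` in each of the four cases. -/
def traceTriple : TraceCase → ℝ × ℝ × ℝ
  | .I => (√5, 2 * √5, 5)
  | .II => (√6, 2 * √3, 3 * √2)
  | .III => (2 * √2, 2 * √2, 4)
  | .IV => (3, 3, 3)

/-- `α` and `β` have the traces prescribed in case `c`. -/
def HasTraces (c : TraceCase) (α β : SL(2, ℝ)) : Prop :=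
  ((α : Matrix (Fin 2) (Fin 2) ℝ).trace,
    (β : Matrix (Fin 2) (Fin 2) ℝ).trace,
    ((α * β : SL(2, ℝ)) : Matrix (Fin 2) (Fin 2) ℝ).trace) = traceTriple c

/-- The group `Γ` generated by `α`, `β` and a group of signs `Z`. For `Z = {1}` this is `⟨α, β⟩`,
and for `Z = {1, -1}` it is the full inverse image in `SL₂(ℝ)` of the group generated by the
classes of `α` and `β` in `PSL₂(ℝ)`. -/
def Gam (α β : SL(2, ℝ)) (Z : Subgroup SL(2, ℝ)) : Subgroup SL(2, ℝ) :=
  Subgroup.closure {α, β} ⊔ Z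

/-- `Γ⁽²⁾`, the group generated by the squares of the elements of `Γ`. -/
def squares (Γ : Subgroup SL(2, ℝ)) : Subgroup SL(2, ℝ) :=
  Subgroup.closure {x | ∃ γ ∈ Γ, x = γ ^ 2}

/-- The tabulated group `Γ'`: it is `⟨Γ⁽²⁾, αβ⟩` in the cases I and III, `Γ⁽²⁾` in case II and `Γ`
in case IV; in each case the signs `Z` that belong to `Γ` are added. -/
def GamPrime (c : TraceCase) (α β : SL(2, ℝ)) (Z : Subgroup SL(2, ℝ)) : Subgroup SL(2, ℝ) :=
  match c with
  | .I => squares (Gam α β Z) ⊔ Subgroup.zpowers (α * β) ⊔ Z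
  | .II => squares (Gam α β Z) ⊔ Z
  | .III => squares (Gam α β Z) ⊔ Subgroup.zpowers (α * β) ⊔ Z
  | .IV => Gam α β Z

/-- The rational vector space `B` spanned by `1, α², β², α²β²` inside `M₂(ℝ)`. -/
def quatSpace (α β : SL(2, ℝ)) : Submodule ℚ (Matrix (Fin 2) (Fin 2) ℝ) :=
  Submodule.span ℚ
    {1, (α : Matrix (Fin 2) (Fin 2) ℝ) ^ 2, (β : Matrix (Fin 2) (Fin 2) ℝ) ^ 2,
      (α : Matrix (Fin 2) (Fin 2) ℝ) ^ 2 * (β : Matrix (Fin 2) (Fin 2) ℝ) ^ 2}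

/-- The subring `ℤ[H]` of `M₂(ℝ)` generated by a subgroup `H` of `SL₂(ℝ)`. -/
def groupOrder (H : Subgroup SL(2, ℝ)) : Subalgebra ℤ (Matrix (Fin 2) (Fin 2) ℝ) :=
  Algebra.adjoin ℤ {M | ∃ h ∈ H, M = (h : Matrix (Fin 2) (Fin 2) ℝ)}

/-- A subring `O` of `M₂(ℝ)` is an order in `B`: it is finitely generated as a `ℤ`-module and its
rational span is `B`. -/
def IsOrderIn (B : Submodule ℚ (Matrix (Fin 2) (Fin 2) ℝ))
    (O : Subalgebra ℤ (Matrix (Fin 2) (Fin 2) ℝ)) : Prop :=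
  (Subalgebra.toSubmodule O).FG ∧
    Submodule.span ℚ (O : Set (Matrix (Fin 2) (Fin 2) ℝ)) = B

/-- The subgroups between `Γ⁽²⁾` and `Γ` that generate an order in `B`. -/
def orderGroups (α β : SL(2, ℝ)) (Z : Subgroup SL(2, ℝ)) : Set (Subgroup SL(2, ℝ)) :=
  {H | squares (Gam α β Z) ≤ H ∧ H ≤ Gam α β Z ∧ IsOrderIn (quatSpace α β) (groupOrder H)}

/-- Conjugation by `g` maps `O` into `M₂(ℤ)`: `g O g⁻¹ ⊆ M₂(ℤ)`. -/
def ConjIntoIntegral (g : GL (Fin 2) ℝ) (O : Subalgebra ℤ (Matrix (Fin 2) (Fin 2) ℝ)) : Prop :=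
  ∀ M ∈ O, ∃ N : Matrix (Fin 2) (Fin 2) ℤ,
    (g : Matrix (Fin 2) (Fin 2) ℝ) * M * ((g⁻¹ : GL (Fin 2) ℝ) : Matrix (Fin 2) (Fin 2) ℝ) =
      N.map (Int.cast : ℤ → ℝ)

/-- The conjugate `g H g⁻¹` of a subgroup `H` of `SL₂(ℝ)`, as a subgroup of `GL₂(ℝ)`. -/
def conjGroup (g : GL (Fin 2) ℝ) (H : Subgroup SL(2, ℝ)) : Subgroup (GL (Fin 2) ℝ) :=
  (H.map (Matrix.SpecialLinearGroup.toGL : SL(2, ℝ) →* GL (Fin 2) ℝ)).map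
    (MulAut.conj g).toMonoidHom

/-- `SL₂(ℤ)` as a subgroup of `GL₂(ℝ)`. -/
def SL2Int : Subgroup (GL (Fin 2) ℝ) :=
  (Matrix.SpecialLinearGroup.mapGL ℝ : SL(2, ℤ) →* GL (Fin 2) ℝ).range

end OncePunctured

end

namespace OncePunctured

/-! All four triples solve Markov's equation t₁² + t₂² + t₃² = t₁t₂t₃, and this fixes the pair (α,
β) up to conjugacy in GL₂(ℝ) (`exists_conjMat_eq`). In a suitable basis α and β become Atkin–Lehner
matrices of level N = 5, 6, 2, 1, that is, integral matrices of determinant d ∣ N divided by √d. The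
divisors d of α, β, αβ are (5, 5, 1), (6, 3, 2), (2, 2, 1), (1, 1, 1). The level condition is on the
upper right entry, so "Γ₀(N)" here is the transpose of the usual group.

Products of such matrices multiply the divisors modulo squares (`IsAtkinLehner.mul`), so all squares
have d = 1 and Γ⁽²⁾Z lies in Γ₀(N). Since Γ is the union of the cosets of Γ⁽²⁾Z represented by 1, α,
β, αβ, the group Γ′ collects exactly the cosets with d = 1. It is conjugate into SL₂(ℤ), and B
becomes M₂(ℚ), because 1, α², β², α²β² are independent.

An element γ in a remaining coset has √d·γ ∈ B with √d irrational. If γ were also rational, in this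
basis or in any basis where ℤ[Γ′] is integral, a nonzero matrix and its √d-multiple would both be
rational (`not_rat_of_irrational`). This one contradiction gives both maximality and the
intersection with SL₂(ℤ), in `conclusion_of_atkinLehner`. -/

/-! ### Cosets modulo squares -/

/-- If `K` contains all squares of the group generated by `a` and `b`, then `⟨a, b⟩` is covered by
the four cosets `K`, `aK`, `bK`, `abK`. -/
theorem exists_coset_of_squares {G : Type*} [Group G] {a b : G} {K : Subgroup G}
    (hK : ∀ x ∈ Subgroup.closure {a, b}, x ^ 2 ∈ K) {x : G} (hx : x ∈ Subgroup.closure {a, b}) :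
    ∃ k ∈ K, x = k ∨ x = a * k ∨ x = b * k ∨ x = a * b * k := by
  have ha : a ∈ Subgroup.closure {a, b} := Subgroup.subset_closure (by simp)
  have hb : b ∈ Subgroup.closure {a, b} := Subgroup.subset_closure (by simp)
  have sq : ∀ y ∈ Subgroup.closure {a, b}, y * y ∈ K := fun y hy => by
    simpa [pow_two] using hK y hy
  have hai := inv_mem ha
  have hbi := inv_mem hb
  -- Modulo squares the group is abelian of exponent two, so each letter permutes the four cosets.
  -- The witnesses write the correction as a product of squares, as in a²b = b(b⁻¹ab)²; normality of
  -- `K` is not needed.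
  induction hx using Subgroup.closure_induction_left with
  | one => exact ⟨1, one_mem _, Or.inl rfl⟩
  | mul_left y hy z _ ih =>
    obtain ⟨k, hk, ih⟩ := ih
    rcases hy with rfl | rfl
    · rcases ih with rfl | rfl | rfl | rfl
      · exact ⟨z, hk, by simp⟩
      · exact ⟨y * y * k, mul_mem (sq _ ha) hk, by simp [mul_assoc]⟩
      · exact ⟨k, hk, by simp [mul_assoc]⟩
      · refine ⟨(b⁻¹ * y * b) * (b⁻¹ * y * b) * k, mul_mem (sq _ ?_) hk, ?_⟩
        · exact mul_mem (mul_mem hbi ha) hb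
        · right; right; left; group
    · rcases ih with rfl | rfl | rfl | rfl
      · exact ⟨z, hk, by simp⟩
      · refine ⟨(y⁻¹ * a⁻¹) * (y⁻¹ * a⁻¹) * ((a * y * a⁻¹) * (a * y * a⁻¹)) * (a * a) * k,
          mul_mem (mul_mem (mul_mem (sq _ ?_) (sq _ ?_)) (sq _ ha)) hk, ?_⟩
        · exact mul_mem hbi hai
        · exact mul_mem (mul_mem ha hb) hai
        · right; right; right; group
      · exact ⟨y * y * k, mul_mem (sq _ hb) hk, by simp [mul_assoc]⟩
      · refine ⟨(a⁻¹ * a⁻¹) * ((a * y) * (a * y)) * k,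
          mul_mem (mul_mem (sq _ hai) (sq _ (mul_mem ha hb))) hk, ?_⟩
        right; left; group
  | inv_mul_cancel y hy z _ ih =>
    obtain ⟨k, hk, ih⟩ := ih
    rcases hy with rfl | rfl
    · rcases ih with rfl | rfl | rfl | rfl
      · exact ⟨y⁻¹ * y⁻¹ * z, mul_mem (sq _ hai) hk, by right; left; group⟩
      · exact ⟨k, hk, by simp⟩
      · refine ⟨(b⁻¹ * y⁻¹ * b) * (b⁻¹ * y⁻¹ * b) * k, mul_mem (sq _ ?_) hk, ?_⟩
        · exact mul_mem (mul_mem hbi hai) hb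
        · right; right; right; group
      · exact ⟨k, hk, by right; right; left; group⟩
    · rcases ih with rfl | rfl | rfl | rfl
      · exact ⟨y⁻¹ * y⁻¹ * z, mul_mem (sq _ hbi) hk, by right; right; left; group⟩
      · refine ⟨(y⁻¹ * a⁻¹) * (y⁻¹ * a⁻¹) * (a * a) * k,
          mul_mem (mul_mem (sq _ (mul_mem hbi hai)) (sq _ ha)) hk, ?_⟩
        right; right; right; group
      · exact ⟨k, hk, by simp⟩
      · refine ⟨(a⁻¹ * y⁻¹) * (a⁻¹ * y⁻¹) * ((y * a * y⁻¹) * (y * a * y⁻¹)) * (y * y) * k,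
          mul_mem (mul_mem (mul_mem (sq _ ?_) (sq _ ?_)) (sq _ hb)) hk, ?_⟩
        · exact mul_mem hai hbi
        · exact mul_mem (mul_mem hb ha) hbi
        · right; left; group

/-! ### Atkin–Lehner matrices -/

/-- Conjugation of a real matrix by `g`. -/
def conjMat (g : GL (Fin 2) ℝ) : Matrix (Fin 2) (Fin 2) ℝ ≃ₐ[ℝ] Matrix (Fin 2) (Fin 2) ℝ where
  toFun M := g * M * (g⁻¹ : GL (Fin 2) ℝ)
  invFun M := (g⁻¹ : GL (Fin 2) ℝ) * M * g
  left_inv M := by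
    have h : ((g⁻¹ : GL (Fin 2) ℝ) : Matrix (Fin 2) (Fin 2) ℝ) * g = 1 := Units.inv_mul g
    simp only
    rw [← mul_assoc, ← mul_assoc, h, one_mul, mul_assoc, h, mul_one]
  right_inv M := by
    have h : (g : Matrix (Fin 2) (Fin 2) ℝ) * (g⁻¹ : GL (Fin 2) ℝ) = 1 := Units.mul_inv g
    simp only
    rw [← mul_assoc, ← mul_assoc, h, one_mul, mul_assoc, h, mul_one]
  map_mul' M N := by
    have h : ((g⁻¹ : GL (Fin 2) ℝ) : Matrix (Fin 2) (Fin 2) ℝ) * g = 1 := Units.inv_mul g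
    calc _ = (g : Matrix (Fin 2) (Fin 2) ℝ) * M * 1 * N * (g⁻¹ : GL (Fin 2) ℝ) := by
          rw [mul_one]; simp only [mul_assoc]
      _ = _ := by rw [← h]; simp only [mul_assoc]
  map_add' M N := by rw [mul_add, add_mul]
  commutes' r := by
    rw [← Algebra.commutes, mul_assoc]
    exact (congrArg _ (Units.mul_inv g)).trans (mul_one _)

theorem conjMat_apply (g : GL (Fin 2) ℝ) (M : Matrix (Fin 2) (Fin 2) ℝ) :
    conjMat g M = g * M * (g⁻¹ : GL (Fin 2) ℝ) := rfl

theorem det_conjMat (g : GL (Fin 2) ℝ) (M : Matrix (Fin 2) (Fin 2) ℝ) :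
    (conjMat g M).det = M.det := by
  have h : (g : Matrix (Fin 2) (Fin 2) ℝ) * (g⁻¹ : GL (Fin 2) ℝ) = 1 := Units.mul_inv g
  have h' := congrArg Matrix.det h
  rw [Matrix.det_mul, Matrix.det_one] at h'
  rw [conjMat_apply, Matrix.det_mul, Matrix.det_mul]
  linear_combination M.det * h'

/-- The conjugate of `γ` by `g` is an Atkin–Lehner matrix for the divisor `d` of the level
`d * e`. -/
def IsAtkinLehner (g : GL (Fin 2) ℝ) (d e : ℕ) (γ : SL(2, ℝ)) : Prop :=
  ∃ p q r s : ℤ, √d * conjMat g γ 0 0 = d * p ∧ √d * conjMat g γ 0 1 = d * e * q ∧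
    √d * conjMat g γ 1 0 = r ∧ √d * conjMat g γ 1 1 = d * s

theorem conjMat_mul_coe (g : GL (Fin 2) ℝ) (γ δ : SL(2, ℝ)) :
    conjMat g ((γ * δ : SL(2, ℝ)) : Matrix (Fin 2) (Fin 2) ℝ) = conjMat g γ * conjMat g δ := by
  rw [Matrix.SpecialLinearGroup.coe_mul, map_mul]

/-- Since √(uv)·√(vw) = v√(uw), the shared factor v of the two divisors comes out, and it cancels
against the entries of the product. The level is uvwz throughout. -/
theorem IsAtkinLehner.mul {g : GL (Fin 2) ℝ} {u v w z : ℕ} (hv : 0 < v) {γ δ : SL(2, ℝ)}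
    (hγ : IsAtkinLehner g (u * v) (w * z) γ) (hδ : IsAtkinLehner g (v * w) (u * z) δ) :
    IsAtkinLehner g (u * w) (v * z) (γ * δ) := by
  obtain ⟨p, q, r, s, h1, h2, h3, h4⟩ := hγ
  obtain ⟨p', q', r', s', k1, k2, k3, k4⟩ := hδ
  have hv' : (v : ℝ) ≠ 0 := by positivity
  have hs : √((u * v : ℕ) : ℝ) * √((v * w : ℕ) : ℝ) = v * √((u * w : ℕ) : ℝ) := by
    rw [← Real.sqrt_mul (by positivity)]
    push_cast
    rw [show (u : ℝ) * v * (v * w) = v ^ 2 * (u * w) by ring, Real.sqrt_mul (by positivity),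
      Real.sqrt_sq (by positivity)]
  refine ⟨v * p * p' + z * q * r', u * p * q' + w * q * s', r * w * p' + u * s * r',
    z * r * q' + v * s * s', ?_, ?_, ?_, ?_⟩ <;> apply mul_left_cancel₀ hv' <;>
    rw [conjMat_mul_coe, Matrix.mul_apply, Fin.sum_univ_two] <;>
    generalize √((u * v : ℕ) : ℝ) = x at * <;> generalize √((v * w : ℕ) : ℝ) = y at * <;>
    generalize √((u * w : ℕ) : ℝ) = t at * <;> generalize conjMat g γ = X at * <;>
    generalize conjMat g δ = Y at * <;> push_cast at *
  · linear_combination (-(X 0 0 * Y 0 0 + X 0 1 * Y 1 0)) * hs + y * Y 0 0 * h1 + u * v * p * k1 +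
      y * Y 1 0 * h2 + u * v * (w * z) * q * k3
  · linear_combination (-(X 0 0 * Y 0 1 + X 0 1 * Y 1 1)) * hs + y * Y 0 1 * h1 + u * v * p * k2 +
      y * Y 1 1 * h2 + u * v * (w * z) * q * k4
  · linear_combination (-(X 1 0 * Y 0 0 + X 1 1 * Y 1 0)) * hs + y * Y 0 0 * h3 + r * k1 +
      y * Y 1 0 * h4 + u * v * s * k3
  · linear_combination (-(X 1 0 * Y 0 1 + X 1 1 * Y 1 1)) * hs + y * Y 0 1 * h3 + r * k2 +
      y * Y 1 1 * h4 + u * v * s * k4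

theorem IsAtkinLehner.inv {g : GL (Fin 2) ℝ} {d e : ℕ} {γ : SL(2, ℝ)}
    (hγ : IsAtkinLehner g d e γ) : IsAtkinLehner g d e γ⁻¹ := by
  obtain ⟨p, q, r, s, h1, h2, h3, h4⟩ := hγ
  have h : conjMat g ((γ⁻¹ : SL(2, ℝ)) : Matrix (Fin 2) (Fin 2) ℝ) = (conjMat g γ).adjugate := by
    have h : conjMat g γ * conjMat g ((γ⁻¹ : SL(2, ℝ)) : Matrix (Fin 2) (Fin 2) ℝ) = 1 := by
      rw [← conjMat_mul_coe, mul_inv_cancel, Matrix.SpecialLinearGroup.coe_one, map_one]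
    calc _ = (conjMat g γ).adjugate * (conjMat g γ * conjMat g (γ⁻¹ : SL(2, ℝ))) := by
          rw [← mul_assoc, Matrix.adjugate_mul, det_conjMat, γ.det_coe, one_smul, one_mul]
      _ = _ := by rw [h, mul_one]
  rw [IsAtkinLehner, h, Matrix.adjugate_fin_two]
  exact ⟨s, -q, -r, p, by simp [h1, h2, h3, h4]⟩

theorem IsAtkinLehner.one (g : GL (Fin 2) ℝ) (N : ℕ) : IsAtkinLehner g 1 N 1 :=
  ⟨1, 0, 0, 1, by simp⟩

theorem IsAtkinLehner.neg_one (g : GL (Fin 2) ℝ) (N : ℕ) : IsAtkinLehner g 1 N (-1) :=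
  ⟨-1, 0, 0, -1, by simp⟩

/-- In the product rule the whole divisor is shared, so it cancels. This puts Γ⁽²⁾ inside Γ₀(N). -/
theorem IsAtkinLehner.mul_self {g : GL (Fin 2) ℝ} {d e : ℕ} (hd : 0 < d) {γ : SL(2, ℝ)}
    (hγ : IsAtkinLehner g d e γ) : IsAtkinLehner g 1 (d * e) (γ ^ 2) := by
  rw [pow_two]
  exact IsAtkinLehner.mul (u := 1) (v := d) (w := 1) (z := e) hd (by simpa using hγ)
    (by simpa using hγ)

/-- The preimage of `Γ₀(N)` under conjugation by `g`. -/
def eichlerGroup (g : GL (Fin 2) ℝ) (N : ℕ) : Subgroup SL(2, ℝ) where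
  carrier := {γ | IsAtkinLehner g 1 N γ}
  mul_mem' {γ δ} hγ hδ := by
    simpa using IsAtkinLehner.mul (u := 1) (v := 1) (w := 1) (z := N) one_pos (by simpa using hγ)
      (by simpa using hδ)
  one_mem' := .one g N
  inv_mem' h := IsAtkinLehner.inv h

/-- The preimage of the Atkin–Lehner extension of `Γ₀(N)` under conjugation by `g`. -/
def atkinLehnerGroup (g : GL (Fin 2) ℝ) (N : ℕ) (hN : 0 < N) : Subgroup SL(2, ℝ) where
  carrier := {γ | ∃ d e, d * e = N ∧ IsAtkinLehner g d e γ}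
  mul_mem' {γ δ} := by
    rintro ⟨d, e, h, hγ⟩ ⟨d', e', h', hδ⟩
    have hd : 0 < d := Nat.pos_of_ne_zero (by rintro rfl; omega)
    have hd' : 0 < d' := Nat.pos_of_ne_zero (by rintro rfl; omega)
    -- With v the gcd, d = uv, d' = vw and the lcm is uvw, so N = uvwz as the product rule requires.
    obtain ⟨z, hz⟩ : d.lcm d' ∣ N := Nat.lcm_dvd ⟨e, h.symm⟩ ⟨e', h'.symm⟩
    obtain ⟨u, hu⟩ := Nat.gcd_dvd_left d d'
    obtain ⟨w, hw⟩ := Nat.gcd_dvd_right d d'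
    have hv : 0 < d.gcd d' := Nat.gcd_pos_of_pos_left _ hd
    have hl := Nat.gcd_mul_lcm d d'
    generalize d.gcd d' = v at *
    generalize d.lcm d' = l at *
    subst hu hw
    have hl : l = u * v * w := Nat.eq_of_mul_eq_mul_left hv (by rw [hl]; ring)
    subst hl
    have he : e = w * z := Nat.eq_of_mul_eq_mul_left hd (by rw [h, hz]; ring)
    have he' : e' = u * z := Nat.eq_of_mul_eq_mul_left hd' (by rw [h', hz]; ring)
    subst he he'
    exact ⟨u * w, v * z, by rw [hz]; ring, .mul hv (by rwa [mul_comm v u] at hγ) hδ⟩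
  one_mem' := ⟨1, N, one_mul N, .one g N⟩
  inv_mem' := by
    rintro γ ⟨d, e, h, hγ⟩
    exact ⟨d, e, h, hγ.inv⟩

theorem sq_mem_eichlerGroup {g : GL (Fin 2) ℝ} {N : ℕ} {hN : 0 < N} {γ : SL(2, ℝ)}
    (h : γ ∈ atkinLehnerGroup g N hN) : γ ^ 2 ∈ eichlerGroup g N := by
  obtain ⟨d, e, rfl, hγ⟩ := h
  exact hγ.mul_self (Nat.pos_of_ne_zero (by rintro rfl; simp at hN))

theorem IsAtkinLehner.mul_eichler {g : GL (Fin 2) ℝ} {d e : ℕ} {γ δ : SL(2, ℝ)}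
    (hγ : IsAtkinLehner g d e γ) (hδ : δ ∈ eichlerGroup g (d * e)) :
    IsAtkinLehner g d e (γ * δ) := by
  have hδ : IsAtkinLehner g 1 (d * e) δ := hδ
  simpa using IsAtkinLehner.mul (u := d) (v := 1) (w := 1) (z := e) one_pos (by simpa using hγ)
    (by simpa using hδ)

/-! ### Signs and squares in Γ -/

theorem normal_of_signs {Z : Subgroup SL(2, ℝ)} (hZ : Z = ⊥ ∨ Z = Subgroup.zpowers (-1)) :
    Z.Normal := by
  rcases hZ with rfl | rfl
  · infer_instance
  · refine ⟨fun x hx y => ?_⟩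
    obtain ⟨n, rfl⟩ := hx
    have h : Commute y (-1) := by simp [Commute, SemiconjBy]
    have := h.zpow_right n
    simp only
    rw [this.eq, mul_inv_cancel_right]
    exact ⟨n, rfl⟩

theorem signs_le {Z : Subgroup SL(2, ℝ)} (hZ : Z = ⊥ ∨ Z = Subgroup.zpowers (-1))
    {H : Subgroup SL(2, ℝ)} (hH : -1 ∈ H) : Z ≤ H := by
  rcases hZ with rfl | rfl
  · exact bot_le
  · simpa using hH

theorem squares_le (Γ : Subgroup SL(2, ℝ)) : squares Γ ≤ Γ := by
  rw [squares, Subgroup.closure_le]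
  rintro _ ⟨γ, hγ, rfl⟩
  exact pow_mem hγ 2

theorem sq_mem_squares {Γ : Subgroup SL(2, ℝ)} {γ : SL(2, ℝ)} (h : γ ∈ Γ) : γ ^ 2 ∈ squares Γ :=
  Subgroup.subset_closure ⟨γ, h, rfl⟩

theorem exists_coset_of_mem_gam {α β : SL(2, ℝ)} {Z : Subgroup SL(2, ℝ)}
    (hZ : Z = ⊥ ∨ Z = Subgroup.zpowers (-1)) {γ : SL(2, ℝ)} (hγ : γ ∈ Gam α β Z) :
    ∃ k ∈ squares (Gam α β Z) ⊔ Z, γ = k ∨ γ = α * k ∨ γ = β * k ∨ γ = α * β * k := by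
  have := normal_of_signs hZ
  obtain ⟨x, hx, z, hz, rfl⟩ := Subgroup.mem_sup_of_normal_right.1 hγ
  obtain ⟨k, hk, h⟩ := exists_coset_of_squares (K := squares (Gam α β Z) ⊔ Z)
    (fun y hy => Subgroup.mem_sup_left (sq_mem_squares (Subgroup.mem_sup_left hy))) hx
  refine ⟨k * z, mul_mem hk (Subgroup.mem_sup_right hz), ?_⟩
  rcases h with rfl | rfl | rfl | rfl <;> simp [mul_assoc]

/-! ### Integrality, rationality and the space B -/

theorem mem_groupOrder {H : Subgroup SL(2, ℝ)} {γ : SL(2, ℝ)} (h : γ ∈ H) :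
    (γ : Matrix (Fin 2) (Fin 2) ℝ) ∈ groupOrder H :=
  Algebra.subset_adjoin ⟨γ, h, rfl⟩

theorem exists_rat_of_mem_span {g : GL (Fin 2) ℝ}
    {O : Subalgebra ℤ (Matrix (Fin 2) (Fin 2) ℝ)} (hO : ConjIntoIntegral g O)
    {M : Matrix (Fin 2) (Fin 2) ℝ}
    (hM : M ∈ Submodule.span ℚ (O : Set (Matrix (Fin 2) (Fin 2) ℝ))) :
    ∃ N : Matrix (Fin 2) (Fin 2) ℚ, conjMat g M = N.map (Rat.cast : ℚ → ℝ) := by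
  induction hM using Submodule.span_induction with
  | mem x hx =>
    obtain ⟨N, hN⟩ := hO x hx
    refine ⟨N.map (Int.cast : ℤ → ℚ), ?_⟩
    rw [conjMat_apply, hN]
    ext i j
    simp
  | zero => exact ⟨0, by ext i j; simp⟩
  | add x y _ _ hx hy =>
    obtain ⟨N, hN⟩ := hx
    obtain ⟨N', hN'⟩ := hy
    refine ⟨N + N', ?_⟩
    rw [map_add, hN, hN']
    ext i j
    simp
  | smul c x _ hx =>
    obtain ⟨N, hN⟩ := hx
    refine ⟨c • N, ?_⟩
    rw [← Rat.cast_smul_eq_qsmul ℝ c x, map_smul, hN]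
    ext i j
    simp

theorem conjIntoIntegral_of_le_eichlerGroup {g : GL (Fin 2) ℝ} {N : ℕ} {H : Subgroup SL(2, ℝ)}
    (hH : H ≤ eichlerGroup g N) : ConjIntoIntegral g (groupOrder H) := by
  intro M hM
  rw [← conjMat_apply]
  induction hM using Algebra.adjoin_induction with
  | mem x hx =>
    obtain ⟨γ, hγ, rfl⟩ := hx
    obtain ⟨p, q, r, s, h1, h2, h3, h4⟩ := hH hγ
    refine ⟨!![p, N * q; r, s], ?_⟩
    ext i j
    fin_cases i <;> fin_cases j
    · simpa using h1
    · simpa using h2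
    · simpa using h3
    · simpa using h4
  | algebraMap r =>
    refine ⟨(r : Matrix (Fin 2) (Fin 2) ℤ), ?_⟩
    rw [show algebraMap ℤ (Matrix (Fin 2) (Fin 2) ℝ) r = (r : Matrix (Fin 2) (Fin 2) ℝ) from rfl,
      map_intCast]
    exact (map_intCast ((Int.castRingHom ℝ).mapMatrix (m := Fin 2)) r).symm
  | add x y _ _ hx hy =>
    obtain ⟨N, hN⟩ := hx
    obtain ⟨N', hN'⟩ := hy
    refine ⟨N + N', ?_⟩
    rw [map_add, hN, hN']
    exact (map_add (Int.castRingHom ℝ).mapMatrix N N').symm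
  | mul x y _ _ hx hy =>
    obtain ⟨N, hN⟩ := hx
    obtain ⟨N', hN'⟩ := hy
    refine ⟨N * N', ?_⟩
    rw [map_mul, hN, hN']
    exact (map_mul (Int.castRingHom ℝ).mapMatrix N N').symm

/-- `O` sits inside g⁻¹M₂(ℤ)g, a finitely generated module over the Noetherian ring ℤ. -/
theorem fg_of_conjIntoIntegral {g : GL (Fin 2) ℝ} {O : Subalgebra ℤ (Matrix (Fin 2) (Fin 2) ℝ)}
    (hO : ConjIntoIntegral g O) : (Subalgebra.toSubmodule O).FG := by
  let f : Matrix (Fin 2) (Fin 2) ℤ →ₗ[ℤ] Matrix (Fin 2) (Fin 2) ℝ :=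
    ((conjMat g).symm.toAlgHom.toRingHom.comp
      (Int.castRingHom ℝ).mapMatrix).toAddMonoidHom.toIntLinearMap
  have hf : (LinearMap.range f).FG := by
    rw [LinearMap.range_eq_map]
    exact Module.Finite.fg_top.map f
  refine hf.of_le fun M hM => ?_
  obtain ⟨N, hN⟩ := hO M hM
  refine ⟨N, ?_⟩
  change (conjMat g).symm (N.map (Int.cast : ℤ → ℝ)) = M
  rw [← hN, ← conjMat_apply, AlgEquiv.symm_apply_apply]

/-- A matrix of determinant one is conjugate into `SL₂(ℤ)` once its conjugate is integral. -/
theorem mem_SL2Int_of_integral {g : GL (Fin 2) ℝ} {γ : SL(2, ℝ)} {N : Matrix (Fin 2) (Fin 2) ℤ}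
    (h : conjMat g γ = N.map (Int.cast : ℤ → ℝ)) :
    MulAut.conj g (Matrix.SpecialLinearGroup.toGL γ) ∈ SL2Int := by
  have hd : N.det = 1 := by
    have h1 : (N.map (Int.cast : ℤ → ℝ)).det = 1 := by rw [← h, det_conjMat, γ.det_coe]
    have h2 : (N.map (Int.cast : ℤ → ℝ)).det = (N.det : ℝ) := (Int.cast_det N).symm
    exact_mod_cast h2.symm.trans h1
  refine ⟨⟨N, hd⟩, ?_⟩
  apply Units.ext
  rw [MulAut.conj_apply]
  exact h.symm

theorem exists_integral_of_mem_SL2Int {g : GL (Fin 2) ℝ} {γ : SL(2, ℝ)}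
    (h : MulAut.conj g (Matrix.SpecialLinearGroup.toGL γ) ∈ SL2Int) :
    ∃ N : Matrix (Fin 2) (Fin 2) ℤ, conjMat g γ = N.map (Int.cast : ℤ → ℝ) := by
  obtain ⟨N, hN⟩ := h
  exact ⟨N, (congrArg Units.val hN).symm⟩

/-- If `1, α², β², α²β²` are conjugate by `g` to generators of `M₂(ℚ)`, then `B` contains every
matrix whose conjugate by `g` is rational. -/
theorem mem_quatSpace_of_rat {g : GL (Fin 2) ℝ} {α β : SL(2, ℝ)} {A B : Matrix (Fin 2) (Fin 2) ℚ}
    (hA : conjMat g α ^ 2 = A.map (Rat.cast : ℚ → ℝ))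
    (hB : conjMat g β ^ 2 = B.map (Rat.cast : ℚ → ℝ))
    (hspan : ∀ N : Matrix (Fin 2) (Fin 2) ℚ, ∃ c₀ c₁ c₂ c₃ : ℚ,
      N = c₀ • (1 : Matrix (Fin 2) (Fin 2) ℚ) + c₁ • A + c₂ • B + c₃ • (A * B))
    {M : Matrix (Fin 2) (Fin 2) ℝ} {N : Matrix (Fin 2) (Fin 2) ℚ}
    (hM : conjMat g M = N.map (Rat.cast : ℚ → ℝ)) : M ∈ quatSpace α β := by
  obtain ⟨c₀, c₁, c₂, c₃, h⟩ := hspan N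
  have h1 : M = c₀ • (1 : Matrix (Fin 2) (Fin 2) ℝ) + c₁ • (α : Matrix (Fin 2) (Fin 2) ℝ) ^ 2 +
      c₂ • (β : Matrix (Fin 2) (Fin 2) ℝ) ^ 2 +
      c₃ • ((α : Matrix (Fin 2) (Fin 2) ℝ) ^ 2 * (β : Matrix (Fin 2) (Fin 2) ℝ) ^ 2) := by
    apply (conjMat g).injective
    simp only [← Rat.cast_smul_eq_qsmul ℝ, map_add, map_smul, map_mul, map_pow, map_one, hA, hB, hM]
    rw [h]
    ext i j
    simp only [Matrix.add_apply, Matrix.smul_apply, Matrix.mul_apply, Matrix.one_apply,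
      Matrix.map_apply, smul_eq_mul]
    push_cast
    by_cases hij : i = j <;> simp [hij]
  rw [h1, quatSpace]
  refine add_mem (add_mem (add_mem ?_ ?_) ?_) ?_ <;>
    exact Submodule.smul_mem _ _ (Submodule.subset_span (by simp))

theorem quatSpace_le_span {α β : SL(2, ℝ)} {H : Subgroup SL(2, ℝ)} (hα : α ^ 2 ∈ H)
    (hβ : β ^ 2 ∈ H) :
    quatSpace α β ≤ Submodule.span ℚ (groupOrder H : Set (Matrix (Fin 2) (Fin 2) ℝ)) := by
  have ha := mem_groupOrder hα
  have hb := mem_groupOrder hβ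
  rw [Matrix.SpecialLinearGroup.coe_pow] at ha hb
  apply Submodule.span_mono
  rintro _ (rfl | rfl | rfl | rfl)
  exacts [one_mem (groupOrder H), ha, hb, mul_mem ha hb]

/-- Multiplying a nonzero rational matrix by an irrational number never gives a rational one. -/
theorem not_rat_of_irrational {g : GL (Fin 2) ℝ} {γ : SL(2, ℝ)} {t : ℝ} (ht : Irrational t)
    {N N' : Matrix (Fin 2) (Fin 2) ℚ} (h : conjMat g γ = N.map (Rat.cast : ℚ → ℝ))
    (h' : conjMat g (t • (γ : Matrix (Fin 2) (Fin 2) ℝ)) = N'.map (Rat.cast : ℚ → ℝ)) :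
    False := by
  have hN : N = 0 := by
    ext i j
    by_contra hne
    rw [map_smul, h] at h'
    have h1 := congrFun (congrFun h' i) j
    simp only [Matrix.smul_apply, Matrix.map_apply, smul_eq_mul] at h1
    have hm := ht.mul_ratCast hne
    rw [h1] at hm
    exact Rat.not_irrational _ hm
  have h1 := det_conjMat g γ
  rw [h, hN, γ.det_coe] at h1
  simp at h1

/-! ### From Atkin–Lehner matrices to the three conclusions -/

/-- The three conclusions for a group `H` generated by the squares, the signs and a set `S` of
elements conjugate into `Γ₀(N)`, when the cosets of `Γ` outside `H` consist of Atkin–Lehner matrices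
for divisors that are not squares. -/
theorem conclusion_of_atkinLehner {α β : SL(2, ℝ)} {Z : Subgroup SL(2, ℝ)}
    (hZ : Z = ⊥ ∨ Z = Subgroup.zpowers (-1)) {g : GL (Fin 2) ℝ} {N : ℕ} (hN : 0 < N)
    {d₁ e₁ d₂ e₂ d₃ e₃ : ℕ} (h₁ : d₁ * e₁ = N) (h₂ : d₂ * e₂ = N) (h₃ : d₃ * e₃ = N)
    (hα : IsAtkinLehner g d₁ e₁ α) (hβ : IsAtkinLehner g d₂ e₂ β)
    (hαβ : IsAtkinLehner g d₃ e₃ (α * β)) {A B : Matrix (Fin 2) (Fin 2) ℚ}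
    (hA : conjMat g α ^ 2 = A.map (Rat.cast : ℚ → ℝ))
    (hB : conjMat g β ^ 2 = B.map (Rat.cast : ℚ → ℝ))
    (hspan : ∀ N : Matrix (Fin 2) (Fin 2) ℚ, ∃ c₀ c₁ c₂ c₃ : ℚ,
      N = c₀ • (1 : Matrix (Fin 2) (Fin 2) ℚ) + c₁ • A + c₂ • B + c₃ • (A * B))
    {H : Subgroup SL(2, ℝ)} {S : Set SL(2, ℝ)}
    (hH : H = squares (Gam α β Z) ⊔ Z ⊔ Subgroup.closure S)
    (hSΓ : S ⊆ Gam α β Z) (hS : S ⊆ eichlerGroup g N)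
    (hd₁ : α ∈ Subgroup.closure S ∨ Irrational √d₁) (hd₂ : β ∈ Subgroup.closure S ∨ Irrational √d₂)
    (hd₃ : α * β ∈ Subgroup.closure S ∨ Irrational √d₃) :
    IsGreatest (orderGroups α β Z) H ∧
    (∃ g : GL (Fin 2) ℝ, ConjIntoIntegral g (groupOrder H)) ∧
    (∀ g : GL (Fin 2) ℝ, ConjIntoIntegral g (groupOrder H) →
      conjGroup g H = conjGroup g (Gam α β Z) ⊓ SL2Int) := by
  have hΓ : Gam α β Z ≤ atkinLehnerGroup g N hN := by
    refine sup_le ?_ (signs_le hZ ⟨1, N, one_mul N, .neg_one g N⟩)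
    rw [Subgroup.closure_le]
    rintro _ (rfl | rfl)
    exacts [⟨d₁, e₁, h₁, hα⟩, ⟨d₂, e₂, h₂, hβ⟩]
  have hKE : squares (Gam α β Z) ⊔ Z ≤ eichlerGroup g N := by
    refine sup_le ?_ (signs_le hZ (.neg_one g N))
    rw [squares, Subgroup.closure_le]
    rintro _ ⟨γ, hγ, rfl⟩
    exact sq_mem_eichlerGroup (hΓ hγ)
  have hKH : squares (Gam α β Z) ⊔ Z ≤ H := hH ▸ le_sup_left
  have hSH : Subgroup.closure S ≤ H := hH ▸ le_sup_right
  have hHΓ : H ≤ Gam α β Z := by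
    rw [hH]
    exact sup_le (sup_le (squares_le _) le_sup_right) ((Subgroup.closure_le _).2 hSΓ)
  have hHE : H ≤ eichlerGroup g N := by
    rw [hH]
    exact sup_le hKE ((Subgroup.closure_le _).2 hS)
  have hαΓ : α ∈ Gam α β Z := Subgroup.mem_sup_left (Subgroup.subset_closure (by simp))
  have hβΓ : β ∈ Gam α β Z := Subgroup.mem_sup_left (Subgroup.subset_closure (by simp))
  have hint := conjIntoIntegral_of_le_eichlerGroup hHE
  have hB_le : quatSpace α β ≤
      Submodule.span ℚ (groupOrder H : Set (Matrix (Fin 2) (Fin 2) ℝ)) :=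
    quatSpace_le_span (hKH (Subgroup.mem_sup_left (sq_mem_squares hαΓ)))
      (hKH (Subgroup.mem_sup_left (sq_mem_squares hβΓ)))
  -- The conjugator `g'` is arbitrary: √d·wk ∈ B is seen with `g`, and B lies in the ℚ-span of ℤ[H],
  -- which `g'` also makes rational.
  have hcoset : ∀ {d e : ℕ} {w k : SL(2, ℝ)}, d * e = N → IsAtkinLehner g d e w →
      (w ∈ H ∨ Irrational √d) → k ∈ squares (Gam α β Z) ⊔ Z →
      ∀ g' : GL (Fin 2) ℝ, ConjIntoIntegral g' (groupOrder H) →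
      (∃ M : Matrix (Fin 2) (Fin 2) ℚ,
        conjMat g' ((w * k : SL(2, ℝ)) : Matrix (Fin 2) (Fin 2) ℝ) =
          M.map (Rat.cast : ℚ → ℝ)) → w * k ∈ H := by
    intro d e w k hde hw hor hk g' hg' ⟨M, hM⟩
    rcases hor with h | h
    · exact mul_mem h (hKH hk)
    · exfalso
      obtain ⟨p, q, r, s, e1, e2, e3, e4⟩ := hw.mul_eichler (hde ▸ hKE hk)
      have hB' : √d • ((w * k : SL(2, ℝ)) : Matrix (Fin 2) (Fin 2) ℝ) ∈ quatSpace α β := by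
        refine mem_quatSpace_of_rat (N := !![(d * p : ℚ), d * e * q; (r : ℚ), d * s])
          hA hB hspan ?_
        rw [map_smul]
        ext i j
        fin_cases i <;> fin_cases j
        · simpa using e1
        · simpa using e2
        · simpa using e3
        · simpa using e4
      obtain ⟨M', hM'⟩ := exists_rat_of_mem_span hg' (hB_le hB')
      exact not_rat_of_irrational h hM hM'
  have hkey : ∀ {γ : SL(2, ℝ)}, γ ∈ Gam α β Z → ∀ g' : GL (Fin 2) ℝ,
      ConjIntoIntegral g' (groupOrder H) → (∃ M : Matrix (Fin 2) (Fin 2) ℚ,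
        conjMat g' γ = M.map (Rat.cast : ℚ → ℝ)) → γ ∈ H := by
    intro γ hγ g' hg' hM
    obtain ⟨k, hk, rfl | rfl | rfl | rfl⟩ := exists_coset_of_mem_gam hZ hγ
    · exact hKH hk
    · exact hcoset h₁ hα (hd₁.imp_left (hSH ·)) hk g' hg' hM
    · exact hcoset h₂ hβ (hd₂.imp_left (hSH ·)) hk g' hg' hM
    · exact hcoset h₃ hαβ (hd₃.imp_left (hSH ·)) hk g' hg' hM
  refine ⟨⟨⟨le_sup_left.trans hKH, hHΓ, fg_of_conjIntoIntegral hint, le_antisymm ?_ hB_le⟩, ?_⟩,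
    ⟨g, hint⟩, ?_⟩
  · intro M hM
    obtain ⟨M', hM'⟩ := exists_rat_of_mem_span hint hM
    exact mem_quatSpace_of_rat hA hB hspan hM'
  · rintro H' ⟨-, hH', -, hO⟩ γ hγ
    have h : (γ : Matrix (Fin 2) (Fin 2) ℝ) ∈ quatSpace α β :=
      hO ▸ Submodule.subset_span (mem_groupOrder hγ)
    exact hkey (hH' hγ) g hint (exists_rat_of_mem_span hint (hB_le h))
  · intro g' hg'
    ext x
    constructor
    · rintro ⟨_, ⟨γ, hγ, rfl⟩, rfl⟩
      obtain ⟨M, hM⟩ := hg' γ (mem_groupOrder hγ)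
      exact ⟨⟨_, ⟨γ, hHΓ hγ, rfl⟩, rfl⟩, mem_SL2Int_of_integral hM⟩
    · rintro ⟨⟨_, ⟨γ, hγ, rfl⟩, rfl⟩, hx⟩
      obtain ⟨M, hM⟩ := exists_integral_of_mem_SL2Int hx
      refine ⟨_, ⟨γ, hkey hγ g' hg' ⟨M.map (Int.cast : ℤ → ℚ), ?_⟩, rfl⟩, rfl⟩
      rw [hM]
      ext i j
      simp

/-! ### Normal form of a Markov pair -/

/-- Two elements of `SL₂(ℝ)` whose traces satisfy Markov's equation are conjugate to an explicit
pair, which depends on a scaling `s` of the second basis vector. -/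
theorem exists_conjMat_eq {α β : SL(2, ℝ)} {t₁ t₂ t₃ : ℝ}
    (h₁ : (α : Matrix (Fin 2) (Fin 2) ℝ).trace = t₁)
    (h₂ : (β : Matrix (Fin 2) (Fin 2) ℝ).trace = t₂)
    (h₃ : ((α * β : SL(2, ℝ)) : Matrix (Fin 2) (Fin 2) ℝ).trace = t₃)
    (hM : t₁ ^ 2 + t₂ ^ 2 + t₃ ^ 2 = t₁ * t₂ * t₃) (ht : t₁ ≠ 0) {s u p q r v : ℝ}
    (hs : s * u = 1) (hp : t₁ * p = t₁ * t₂ - t₃) (hq : t₁ * q = -(s * t₂))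
    (hr : t₁ * r = -(u * t₂)) (hv : t₁ * v = t₃) :
    ∃ g : GL (Fin 2) ℝ, conjMat g α = !![0, -s; u, t₁] ∧ conjMat g β = !![p, q; r, v] := by
  have hdA := α.det_coe
  have hdB := β.det_coe
  rw [Matrix.SpecialLinearGroup.coe_mul] at h₃
  generalize (α : Matrix (Fin 2) (Fin 2) ℝ) = A at *
  generalize (β : Matrix (Fin 2) (Fin 2) ℝ) = B at *
  rw [Matrix.det_fin_two] at hdA hdB
  rw [Matrix.trace_fin_two] at h₁ h₂ h₃
  rw [Matrix.mul_apply, Matrix.mul_apply, Fin.sum_univ_two, Fin.sum_univ_two] at h₃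
  have hs0 : s ≠ 0 := left_ne_zero_of_mul_eq_one hs
  -- The determinant of this combination is t₁² + t₂² + t₃² − t₁t₂t₃ = 0. A kernel vector w has Bw
  -- in the span of w and Aw, and the new basis is w, s·Aw.
  obtain ⟨w, hw, hMw⟩ : ∃ w, w ≠ 0 ∧
      (t₁ • B + t₂ • A + (t₃ - t₁ * t₂) • (1 : Matrix (Fin 2) (Fin 2) ℝ)).mulVec w = 0 := by
    rw [Matrix.exists_mulVec_eq_zero_iff, Matrix.det_fin_two]
    simp only [Matrix.add_apply, Matrix.smul_apply, smul_eq_mul, Matrix.one_apply_eq,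
      Matrix.one_apply_ne (zero_ne_one : (0 : Fin 2) ≠ 1),
      Matrix.one_apply_ne (one_ne_zero : (1 : Fin 2) ≠ 0)]
    subst h₁ h₂ h₃
    linear_combination hM + (A 0 0 + A 1 1) ^ 2 * hdB + (B 0 0 + B 1 1) ^ 2 * hdA
  have e0 := congrFun hMw 0
  have e1 := congrFun hMw 1
  simp only [Matrix.mulVec, dotProduct, Fin.sum_univ_two, Matrix.add_apply, Matrix.smul_apply,
    smul_eq_mul, Matrix.one_apply_eq, Matrix.one_apply_ne (zero_ne_one : (0 : Fin 2) ≠ 1),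
    Matrix.one_apply_ne (one_ne_zero : (1 : Fin 2) ≠ 0), Pi.zero_apply] at e0 e1
  obtain ⟨x, hx⟩ : ∃ x, A 0 0 * w 0 + A 0 1 * w 1 = x := ⟨_, rfl⟩
  obtain ⟨y, hy⟩ : ∃ y, A 1 0 * w 0 + A 1 1 * w 1 = y := ⟨_, rfl⟩
  have c0 : A 0 0 * x + A 0 1 * y = t₁ * x - w 0 := by
    subst h₁ hx hy
    linear_combination -w 0 * hdA
  have c1 : A 1 0 * x + A 1 1 * y = t₁ * y - w 1 := by
    subst h₁ hx hy
    linear_combination -w 1 * hdA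
  -- The action of B on Aw comes from applying A⁻¹ = t₁ − A to the kernel relation.
  have f0 : t₁ * (B 0 0 * x + B 0 1 * y) = t₃ * x - t₂ * w 0 := by
    subst h₁ h₂ h₃ hx hy
    linear_combination (A 0 0 + A 1 1) * e0 - (A 0 0 * e0 + A 0 1 * e1) -
      (B 0 0 + B 1 1) * w 0 * hdA
  have f1 : t₁ * (B 1 0 * x + B 1 1 * y) = t₃ * y - t₂ * w 1 := by
    subst h₁ h₂ h₃ hx hy
    linear_combination (A 0 0 + A 1 1) * e1 - (A 1 0 * e0 + A 1 1 * e1) -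
      (B 0 0 + B 1 1) * w 1 * hdA
  have b0 : t₁ * (B 0 0 * w 0 + B 0 1 * w 1) = (t₁ * t₂ - t₃) * w 0 - t₂ * x := by
    linear_combination e0 - t₂ * hx
  have b1 : t₁ * (B 1 0 * w 0 + B 1 1 * w 1) = (t₁ * t₂ - t₃) * w 1 - t₂ * y := by
    linear_combination e1 - t₂ * hy
  set P : Matrix (Fin 2) (Fin 2) ℝ := !![w 0, s * x; w 1, s * y] with hP
  have hAP : A * P = P * !![0, -s; u, t₁] := by
    rw [Matrix.eta_fin_two A, hP, Matrix.mul_fin_two, Matrix.mul_fin_two]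
    congr 1
    simp only [Matrix.vecCons_inj, and_true]
    refine ⟨⟨?_, ?_⟩, ?_, ?_⟩
    · linear_combination hx - x * hs
    · linear_combination s * c0
    · linear_combination hy - y * hs
    · linear_combination s * c1
  have hBP : B * P = P * !![p, q; r, v] := by
    rw [Matrix.eta_fin_two B, hP, Matrix.mul_fin_two, Matrix.mul_fin_two]
    congr 1
    simp only [Matrix.vecCons_inj, and_true]
    refine ⟨⟨?_, ?_⟩, ?_, ?_⟩ <;> apply mul_left_cancel₀ ht
    · linear_combination b0 - w 0 * hp - s * x * hr + t₂ * x * hs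
    · linear_combination s * f0 - w 0 * hq - s * x * hv
    · linear_combination b1 - w 1 * hp - s * y * hr + t₂ * y * hs
    · linear_combination s * f1 - w 1 * hq - s * y * hv
  -- Otherwise Aw = lw with l² − t₁l + 1 = 0, and the two formulas for B force t₃l = t₂. Eliminating
  -- l gives t₂² + t₃² = t₁t₂t₃, so t₁ = 0 by Markov's equation.
  have hdet : P.det ≠ 0 := by
    intro h0
    rw [hP, Matrix.det_fin_two_of] at h0
    have hD : w 0 * y = w 1 * x := by
      apply mul_left_cancel₀ hs0
      linear_combination h0
    obtain ⟨l, hl0, hl1⟩ : ∃ l, x = l * w 0 ∧ y = l * w 1 := by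
      by_cases hw0 : w 0 = 0
      · have hw1 : w 1 ≠ 0 := fun hw1 => hw (by ext i; fin_cases i <;> assumption)
        refine ⟨y / w 1, ?_, by field_simp⟩
        have : w 1 * x = 0 := by rw [← hD, hw0, zero_mul]
        rw [(mul_eq_zero.1 this).resolve_left hw1, hw0, mul_zero]
      · refine ⟨x / w 0, by field_simp, ?_⟩
        field_simp
        linear_combination hD
    subst hl0 hl1
    obtain ⟨i, hi⟩ := Function.ne_iff.1 hw
    have hchar : ∀ i, w i * (l ^ 2 - t₁ * l + 1) = 0 := by
      rw [Fin.forall_fin_two]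
      constructor
      · linear_combination c0 - l * hx
      · linear_combination c1 - l * hy
    have hlin : ∀ i, w i * (2 * (t₃ * l - t₂)) = 0 := by
      rw [Fin.forall_fin_two]
      constructor
      · linear_combination l * b0 - f0 - t₂ * hchar 0
      · linear_combination l * b1 - f1 - t₂ * hchar 1
    have hchar := (mul_eq_zero.1 (hchar i)).resolve_left hi
    have hlin := (mul_eq_zero.1 (hlin i)).resolve_left hi
    have : t₁ ^ 2 = 0 := by
      linear_combination hM - t₃ ^ 2 * hchar + (t₃ * l + t₂ - t₁ * t₃) / 2 * hlin
    exact ht (pow_eq_zero_iff (two_ne_zero)|>.1 this)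
  have hconj : ∀ X Y : Matrix (Fin 2) (Fin 2) ℝ, X * P = P * Y →
      conjMat (Matrix.GeneralLinearGroup.mkOfDetNeZero P hdet)⁻¹ X = Y := by
    intro X Y h
    rw [conjMat_apply, inv_inv, mul_assoc]
    change _ * (X * P) = _
    rw [h, ← mul_assoc]
    exact (congrArg (· * Y) (Units.inv_mul (Matrix.GeneralLinearGroup.mkOfDetNeZero P hdet))).trans
      (one_mul Y)
  exact ⟨_, hconj _ _ hAP, hconj _ _ hBP⟩

/-! ### Explicit matrices and the four cases -/

theorem IsAtkinLehner.of_eq {g : GL (Fin 2) ℝ} {d e : ℕ} {γ : SL(2, ℝ)} {x y z t : ℝ}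
    (h : conjMat g γ = !![x, y; z, t]) (p q r s : ℤ) (h₁ : √d * x = d * p)
    (h₂ : √d * y = d * e * q) (h₃ : √d * z = r) (h₄ : √d * t = d * s) :
    IsAtkinLehner g d e γ :=
  ⟨p, q, r, s, by simp only [h]; exact ⟨h₁, h₂, h₃, h₄⟩⟩

theorem conjMat_sq_eq_map {g : GL (Fin 2) ℝ} {γ : SL(2, ℝ)} {x y z t : ℝ}
    (h : conjMat g γ = !![x, y; z, t]) {a b c d : ℚ} (h₁ : x * x + y * z = a)
    (h₂ : x * y + y * t = b) (h₃ : z * x + t * z = c) (h₄ : z * y + t * t = d) :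
    conjMat g γ ^ 2 = !![a, b; c, d].map (Rat.cast : ℚ → ℝ) := by
  rw [h, pow_two, Matrix.mul_fin_two, h₁, h₂, h₃, h₄]
  ext i j
  fin_cases i <;> fin_cases j <;> rfl

theorem gamPrime_eq_closure_mul {α β : SL(2, ℝ)} {Z : Subgroup SL(2, ℝ)} :
    squares (Gam α β Z) ⊔ Subgroup.zpowers (α * β) ⊔ Z =
      squares (Gam α β Z) ⊔ Z ⊔ Subgroup.closure {α * β} := by
  rw [Subgroup.zpowers_eq_closure, sup_right_comm]

theorem gam_eq_squares_sup (α β : SL(2, ℝ)) (Z : Subgroup SL(2, ℝ)) :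
    Gam α β Z = squares (Gam α β Z) ⊔ Z ⊔ Subgroup.closure {α, β} :=
  le_antisymm (sup_le le_sup_right (le_sup_right.trans le_sup_left))
    (sup_le (sup_le (squares_le _) le_sup_right) le_sup_left)

theorem IsAtkinLehner.mem_eichlerGroup {g : GL (Fin 2) ℝ} {N : ℕ} {γ : SL(2, ℝ)}
    (h : IsAtkinLehner g 1 N γ) : γ ∈ eichlerGroup g N := h

theorem mem_closure_singleton_mul {α β : SL(2, ℝ)} : α * β ∈ Subgroup.closure {α * β} :=
  Subgroup.subset_closure rfl

theorem mul_mem_gam (α β : SL(2, ℝ)) (Z : Subgroup SL(2, ℝ)) : α * β ∈ Gam α β Z :=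
  Subgroup.mem_sup_left (mul_mem (Subgroup.subset_closure (by simp))
    (Subgroup.subset_closure (by simp)))

end OncePunctured

theorem mainTheorem6 (c : OncePunctured.TraceCase) (α β : SL(2, ℝ))
    (hαβ : OncePunctured.HasTraces c α β)
    (Z : Subgroup SL(2, ℝ)) (hZ : Z = ⊥ ∨ Z = Subgroup.zpowers (-1)) :
    IsGreatest (OncePunctured.orderGroups α β Z) (OncePunctured.GamPrime c α β Z) ∧
    (∃ g : GL (Fin 2) ℝ, OncePunctured.ConjIntoIntegral g
      (OncePunctured.groupOrder (OncePunctured.GamPrime c α β Z))) ∧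
    (∀ g : GL (Fin 2) ℝ, OncePunctured.ConjIntoIntegral g
        (OncePunctured.groupOrder (OncePunctured.GamPrime c α β Z)) →
      OncePunctured.conjGroup g (OncePunctured.GamPrime c α β Z) =
        OncePunctured.conjGroup g (OncePunctured.Gam α β Z) ⊓ OncePunctured.SL2Int) := by
  open OncePunctured in
  obtain ⟨h₁, h₂, h₃⟩ : _ ∧ _ ∧ _ := by simpa only [HasTraces, Prod.ext_iff] using hαβ
  cases c <;> simp only [traceTriple] at h₁ h₂ h₃
  · have h5 : √(5 : ℝ) ^ 2 = 5 := Real.sq_sqrt (by norm_num)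
    have i5 : Irrational √((5 : ℕ) : ℝ) := by norm_num
    -- In every case the scaling is s = √N, which makes α an Atkin–Lehner matrix for the full
    -- divisor d = N.
    obtain ⟨g, hA, hB⟩ := exists_conjMat_eq h₁ h₂ h₃ (s := √5) (u := √5 / 5) (p := √5)
      (q := -(2 * √5)) (r := -(2 / 5 * √5)) (v := √5) (by linear_combination -5 * h5)
      (by positivity) (by linear_combination h5 / 5) (by linear_combination -h5) (by ring)
      (by ring) (by linear_combination h5)
    have hα : IsAtkinLehner g 5 1 α := .of_eq hA 0 (-1) 1 1
      (by push_cast; ring)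
      (by push_cast; linear_combination -h5)
      (by push_cast; linear_combination h5 / 5)
      (by push_cast; linear_combination h5)
    have hβ : IsAtkinLehner g 5 1 β := .of_eq hB 1 (-2) (-2) 1
      (by push_cast; linear_combination h5)
      (by push_cast; linear_combination -2 * h5)
      (by push_cast; linear_combination -(2 / 5) * h5)
      (by push_cast; linear_combination h5)
    have hαβ : IsAtkinLehner g 1 5 (α * β) :=
      IsAtkinLehner.mul (u := 1) (v := 5) (w := 1) (z := 1) (by norm_num) hα hβ
    refine conclusion_of_atkinLehner hZ (N := 5) (by norm_num) (by norm_num) (by norm_num)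
      (by norm_num) hα hβ hαβ
      (conjMat_sq_eq_map hA (a := -1) (b := -5) (c := 1) (d := 4)
        (by push_cast; linear_combination -h5 / 5)
        (by push_cast; linear_combination -h5)
        (by push_cast; linear_combination h5 / 5)
        (by push_cast; linear_combination 4 / 5 * h5))
      (conjMat_sq_eq_map hB (a := 9) (b := -20) (c := -4) (d := 9)
        (by push_cast; linear_combination 9 / 5 * h5)
        (by push_cast; linear_combination -4 * h5)
        (by push_cast; linear_combination -(4 / 5) * h5)
        (by push_cast; linear_combination 9 / 5 * h5))
      -- Coordinates of M in the basis 1, A, B, AB, found by inverting the 4 × 4 system; likewise in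
      -- the other cases.
      (fun M => ⟨13/20 * M 0 0 + 3/10 * M 0 1 + 3/4 * M 1 0 + 7/20 * M 1 1,
        (-1/10) * M 0 0 + (-1/20) * M 0 1 + 1/4 * M 1 0 + 1/10 * M 1 1,
        3/20 * M 0 0 + (-1/10) * M 0 1 + 1/4 * M 1 0 + (-3/20) * M 1 1,
        (-1/10) * M 0 0 + 1/20 * M 0 1 + (-1/4) * M 1 0 + 1/10 * M 1 1, ?_⟩)
      gamPrime_eq_closure_mul (by simpa using mul_mem_gam α β Z)
      (by simpa using hαβ.mem_eichlerGroup)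
      (.inr i5) (.inr i5) (.inl mem_closure_singleton_mul)
    ext i j
    fin_cases i <;> fin_cases j <;> simp <;> ring
  · have h2 : √(2 : ℝ) ^ 2 = 2 := Real.sq_sqrt (by norm_num)
    have h3 : √(3 : ℝ) ^ 2 = 3 := Real.sq_sqrt (by norm_num)
    have h6 : √(6 : ℝ) ^ 2 = 6 := Real.sq_sqrt (by norm_num)
    have h23 : √(6 : ℝ) = √2 * √3 := by
      rw [← Real.sqrt_mul (by norm_num)]
      norm_num
    have i2 : Irrational √((2 : ℕ) : ℝ) := by norm_num
    have i3 : Irrational √((3 : ℕ) : ℝ) := by norm_num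
    have i6 : Irrational √((6 : ℕ) : ℝ) := by norm_num
    obtain ⟨g, hA, hB⟩ := exists_conjMat_eq h₁ h₂ h₃ (s := √6) (u := √6 / 6) (p := √3)
      (q := -(2 * √3)) (r := -(√3 / 3)) (v := √3)
      (by linear_combination h6 + 4 * h3 + 9 * h2 - 6 * √2 * √3 * h23 - 6 * √3 ^ 2 * h2 - 12 * h3)
      (by positivity) (by linear_combination h6 / 6)
      (by linear_combination -√3 * h23 - √2 * h3)
      (by ring) (by ring) (by linear_combination √3 * h23 + √2 * h3)
    have hα : IsAtkinLehner g 6 1 α := .of_eq hA 0 (-1) 1 1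
      (by push_cast; ring)
      (by push_cast; linear_combination -h6)
      (by push_cast; linear_combination h6 / 6)
      (by push_cast; linear_combination h6)
    have hβ : IsAtkinLehner g 3 2 β := .of_eq hB 1 (-1) (-1) 1
      (by push_cast; linear_combination h3)
      (by push_cast; linear_combination -2 * h3)
      (by push_cast; linear_combination -h3 / 3)
      (by push_cast; linear_combination h3)
    have hαβ : IsAtkinLehner g 2 3 (α * β) :=
      IsAtkinLehner.mul (u := 2) (v := 3) (w := 1) (z := 1) (by norm_num) hα hβ
    refine conclusion_of_atkinLehner hZ (N := 6) (by norm_num) (by norm_num) (by norm_num)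
      (by norm_num) hα hβ hαβ
      (conjMat_sq_eq_map hA (a := -1) (b := -6) (c := 1) (d := 5)
        (by push_cast; linear_combination -h6 / 6)
        (by push_cast; linear_combination -h6)
        (by push_cast; linear_combination h6 / 6)
        (by push_cast; linear_combination 5 / 6 * h6))
      (conjMat_sq_eq_map hB (a := 5) (b := -12) (c := -2) (d := 5)
        (by push_cast; linear_combination 5 / 3 * h3)
        (by push_cast; linear_combination -4 * h3)
        (by push_cast; linear_combination -(2 / 3) * h3)
        (by push_cast; linear_combination 5 / 3 * h3))
      (fun M => ⟨2/3 * M 0 0 + 7/24 * M 0 1 + 3/4 * M 1 0 + 1/3 * M 1 1,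
        (-1/12) * M 0 0 + (-1/24) * M 0 1 + 1/4 * M 1 0 + 1/12 * M 1 1,
        1/6 * M 0 0 + (-1/8) * M 0 1 + 1/4 * M 1 0 + (-1/6) * M 1 1,
        (-1/12) * M 0 0 + 1/24 * M 0 1 + (-1/4) * M 1 0 + 1/12 * M 1 1, ?_⟩)
      -- The divisors 6, 3, 2 are all nonsquares, so no further coset joins Γ⁽²⁾Z.
      (S := ∅) (by simp [GamPrime]) (by simp) (by simp) (.inr i6) (.inr i3) (.inr i2)
    ext i j
    fin_cases i <;> fin_cases j <;> simp <;> ring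
  · have h2 : √(2 : ℝ) ^ 2 = 2 := Real.sq_sqrt (by norm_num)
    have i2 : Irrational √((2 : ℕ) : ℝ) := by norm_num
    obtain ⟨g, hA, hB⟩ := exists_conjMat_eq h₁ h₂ h₃ (s := √2) (u := √2 / 2) (p := √2)
      (q := -√2) (r := -(√2 / 2)) (v := √2) (by linear_combination -8 * h2)
      (by positivity) (by linear_combination h2 / 2) (by linear_combination -2 * h2) (by ring)
      (by ring) (by linear_combination 2 * h2)
    have hα : IsAtkinLehner g 2 1 α := .of_eq hA 0 (-1) 1 2
      (by push_cast; ring)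
      (by push_cast; linear_combination -h2)
      (by push_cast; linear_combination h2 / 2)
      (by push_cast; linear_combination 2 * h2)
    have hβ : IsAtkinLehner g 2 1 β := .of_eq hB 1 (-1) (-1) 1
      (by push_cast; linear_combination h2)
      (by push_cast; linear_combination -h2)
      (by push_cast; linear_combination -h2 / 2)
      (by push_cast; linear_combination h2)
    have hαβ : IsAtkinLehner g 1 2 (α * β) :=
      IsAtkinLehner.mul (u := 1) (v := 2) (w := 1) (z := 1) (by norm_num) hα hβ
    refine conclusion_of_atkinLehner hZ (N := 2) (by norm_num) (by norm_num) (by norm_num)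
      (by norm_num) hα hβ hαβ
      (conjMat_sq_eq_map hA (a := -1) (b := -4) (c := 2) (d := 7)
        (by push_cast; linear_combination -h2 / 2)
        (by push_cast; linear_combination -2 * h2)
        (by push_cast; linear_combination h2)
        (by push_cast; linear_combination 7 / 2 * h2))
      (conjMat_sq_eq_map hB (a := 3) (b := -4) (c := -2) (d := 3)
        (by push_cast; linear_combination 3 / 2 * h2)
        (by push_cast; linear_combination -2 * h2)
        (by push_cast; linear_combination -h2)
        (by push_cast; linear_combination 3 / 2 * h2))
      (fun M => ⟨11/16 * M 0 0 + 9/16 * M 0 1 + 3/8 * M 1 0 + 5/16 * M 1 1,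
        (-1/16) * M 0 0 + (-1/16) * M 0 1 + 1/8 * M 1 0 + 1/16 * M 1 1,
        3/16 * M 0 0 + (-5/16) * M 0 1 + 1/8 * M 1 0 + (-3/16) * M 1 1,
        (-1/16) * M 0 0 + 1/16 * M 0 1 + (-1/8) * M 1 0 + 1/16 * M 1 1, ?_⟩)
      gamPrime_eq_closure_mul (by simpa using mul_mem_gam α β Z)
      (by simpa using hαβ.mem_eichlerGroup)
      (.inr i2) (.inr i2) (.inl mem_closure_singleton_mul)
    ext i j
    fin_cases i <;> fin_cases j <;> simp <;> ring
  · obtain ⟨g, hA, hB⟩ := exists_conjMat_eq h₁ h₂ h₃ (s := 1) (u := 1) (p := 2)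
      (q := -1) (r := -1) (v := 1) (by norm_num)
      (by norm_num) (by norm_num) (by norm_num) (by norm_num) (by norm_num) (by norm_num)
    have hα : IsAtkinLehner g 1 1 α := .of_eq hA 0 (-1) 1 3
      (by push_cast; simp)
      (by push_cast; simp)
      (by push_cast; simp)
      (by push_cast; simp)
    have hβ : IsAtkinLehner g 1 1 β := .of_eq hB 2 (-1) (-1) 1
      (by push_cast; simp)
      (by push_cast; simp)
      (by push_cast; simp)
      (by push_cast; simp)
    have hαβ : IsAtkinLehner g 1 1 (α * β) :=
      IsAtkinLehner.mul (u := 1) (v := 1) (w := 1) (z := 1) (by norm_num) hα hβ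
    refine conclusion_of_atkinLehner hZ (N := 1) (by norm_num) (by norm_num) (by norm_num)
      (by norm_num) hα hβ hαβ
      (conjMat_sq_eq_map hA (a := -1) (b := -3) (c := 3) (d := 8)
        (by push_cast; norm_num)
        (by push_cast; norm_num)
        (by push_cast; norm_num)
        (by push_cast; norm_num))
      (conjMat_sq_eq_map hB (a := 5) (b := -3) (c := -3) (d := 2)
        (by push_cast; norm_num)
        (by push_cast; norm_num)
        (by push_cast; norm_num)
        (by push_cast; norm_num))
      (fun M => ⟨11/18 * M 0 0 + 19/18 * M 0 1 + 2/9 * M 1 0 + 7/18 * M 1 1,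
        (-1/18) * M 0 0 + (-1/9) * M 0 1 + 1/18 * M 1 0 + 1/18 * M 1 1,
        1/9 * M 0 0 + (-5/18) * M 0 1 + 1/18 * M 1 0 + (-1/9) * M 1 1,
        (-1/18) * M 0 0 + 1/18 * M 0 1 + (-1/9) * M 1 0 + 1/18 * M 1 1, ?_⟩)
      -- At level 1 every divisor is 1, so all cosets are included and irrationality plays no role.
      (S := {α, β}) (gam_eq_squares_sup α β Z)
      (Subgroup.subset_closure.trans (SetLike.coe_subset_coe.2 le_sup_left))
      (by rintro _ (rfl | rfl); exacts [hα, hβ])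
      (.inl (Subgroup.subset_closure (by simp))) (.inl (Subgroup.subset_closure (by simp)))
      (.inl (mul_mem (Subgroup.subset_closure (by simp)) (Subgroup.subset_closure (by simp))))
    ext i j
    fin_cases i <;> fin_cases j <;> simp <;> ring
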